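/- A sign pattern $\mathcal P=[p_{ij}]$ of order $n$ is an $n\times n$ matrix with entries in $\{+,-,0\}$; its qualitative class $\mathcal Q(\mathcal P)$ is the set of real $n\times n$ matrices $A=[a_{ij}]$ with $\operatorname{sgn}(a_{ij})=p_{ij}$ for all $i,j$. Call $\mathcal P$ sign singular if every $A\in\mathcal Q(\mathcal P)$ is singular, and $2$-consistent if every $A\in\mathcal Q(\mathcal P)$ has exactly two real eigenvalues, counted with algebraic multiplicity. Let $D$ be the signed directed graph of $\mathcal P$: its vertices are $1,\dots,n$, and it has an edge $(i,j)$, with sign $p_{ij}$, exactly when $p_{ij}\ne 0$. A cycle of length $k\ge 1$ in $D$ is $\gamma=(i_1,\dots,i_k)$ with $i_1,\dots,i_k$ distinct and $p_{i_1i_2},p_{i_2i_3},\dots,p_{i_ki_1}$ all nonzero; it is even or odd according to the parity of $k$, and its sign is $\operatorname{sgn}(\gamma)=(-1)^{k-1}p_{i_1i_2}p_{i_2i_3}\cdots p_{i_ki_1}$. A composite cycle $\Gamma=\gamma_1\cdots\gamma_t$ in $D$ consists of $t\ge 0$ mutually vertex-disjoint cycles of $D$; its length is the sum of the lengths of the $\gamma_i$,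 and its sign is $\prod_i\operatorname{sgn}(\gamma_i)$ (so the empty one, $t=0$, has length $0$). Theorem. Let $\mathcal P$ be a sign pattern of order $n$ that is sign singular and $2$-consistent, with signed directed graph $D$. Then: 1. All even cycles in $D$ are nonnegative. 2. Every $p\times q$ zero submatrix of $\mathcal P$ satisfies $p+q\le n+2$. 3. If $\gamma=(i_1,\dots,i_k)$ is an odd cycle in $D$, then the signed directed graph of the principal subpattern $\mathcal P[\{i_1,\dots,i_k\}^c]$ contains no odd cycle. 4. If $D$ has no composite cycle of length $n-1$, then all cycles in $D$ are even and nonnegative, and moreover $D$ has a composite cycle of length $n-2$. 5. If $D$ has a composite cycle of length $n-1$, and all composite cycles of length $n-1$ in $D$ have the same sign, then all odd cycles in $D$ have the same sign. 6. If $D$ has two composite cycles of length $n-1$ of opposite sign, then $D$ has a composite cycle of length $n-2$. -/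

import Mathlib

/-- A square sign pattern with rows and columns indexed by `ι`; the entries `+`, `-`, `0` are the
elements `1`, `-1`, `0` of `SignType`. -/
abbrev SignPattern (ι : Type*) := Matrix ι ι SignType

namespace SignPattern

variable {ι : Type*}

/-- The qualitative class of `P`: all real matrices whose entries have the signs prescribed
by `P`. -/
def qualitativeClass (P : SignPattern ι) : Set (Matrix ι ι ℝ) :=
  {A | ∀ i j, SignType.sign (A i j) = P i j}

/-- `P` is sign singular if it requires singularity. -/
def SignSingular [Fintype ι] [DecidableEq ι] (P : SignPattern ι) : Prop :=
  ∀ A ∈ P.qualitativeClass, A.det = 0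

/-- The number of real eigenvalues of a real matrix, counted with algebraic multiplicity. -/
noncomputable def realEigenvalueCount [Fintype ι] [DecidableEq ι] (A : Matrix ι ι ℝ) : ℕ :=
  A.charpoly.roots.card

/-- `P` is `k`-consistent if every matrix in its qualitative class has exactly `k` real
eigenvalues. -/
def IsConsistentOf [Fintype ι] [DecidableEq ι] (k : ℕ) (P : SignPattern ι) : Prop :=
  ∀ A ∈ P.qualitativeClass, realEigenvalueCount A = k

/-- The principal subpattern `P[s]`. -/
def principal (P : SignPattern ι) (s : Set ι) : SignPattern s :=
  P.submatrix Subtype.val Subtype.val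

/-- A (nonzero, simple) cycle `(i₁, …, iₖ)`, `k ≥ 1`, in the signed directed graph of `P`, which
has a directed edge `(i, j)` exactly when `P i j ≠ 0`. The permutation `finRotate length` sends
each position to the next one and the last position to the first. Loops are the cycles of
length `1`. -/
structure SimpleCycle (P : SignPattern ι) where
  /-- the length `k` of the cycle -/
  length : ℕ
  length_pos : 0 < length
  /-- the distinct vertices `i₁, …, iₖ` -/
  vertex : Fin length ↪ ι
  edge_ne_zero : ∀ t, P (vertex t) (vertex (finRotate length t)) ≠ 0

/-- The set of vertices of a cycle. -/
def SimpleCycle.support {P : SignPattern ι} (γ : P.SimpleCycle) : Set ι :=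
  Set.range γ.vertex

/-- The sign of a cycle of length `k`: `(-1)^(k-1)` times the product of the signs of its
edges. -/
def SimpleCycle.sgn {P : SignPattern ι} (γ : P.SimpleCycle) : SignType :=
  (-1) ^ (γ.length - 1) * ∏ t, P (γ.vertex t) (γ.vertex (finRotate γ.length t))

/-- A composite cycle `γ₁γ₂⋯γₜ`: finitely many mutually vertex disjoint cycles. The empty product
(`t = 0`) is allowed; it is the only composite cycle of length `0`. -/
structure CompositeCycle (P : SignPattern ι) where
  /-- the number `t` of cycles -/
  count : ℕ
  /-- the cycles `γ₁, …, γₜ` -/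
  cycle : Fin count → P.SimpleCycle
  disjoint : ∀ a b, a ≠ b → Disjoint (cycle a).support (cycle b).support

/-- The length of a composite cycle is the sum of the lengths of its cycles. -/
def CompositeCycle.length {P : SignPattern ι} (Γ : P.CompositeCycle) : ℕ :=
  ∑ a, (Γ.cycle a).length

/-- The sign of a composite cycle is the product of the signs of its cycles. -/
def CompositeCycle.sgn {P : SignPattern ι} (Γ : P.CompositeCycle) : SignType :=
  ∏ a, (Γ.cycle a).sgn

end SignPattern

open Polynomial

/-! Up to the factor `(-1)^k`, the coefficient of `X^(n-k)` in the characteristic polynomial is a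
sum of principal minors, and every nonzero Leibniz term of such a minor is carried by a composite
cycle of length `k`, with the same sign (`exists_compositeCycle_of_prod_ne_zero`). Conversely,
keeping only the edges of a chosen composite cycle gives a matrix with an explicit characteristic
polynomial (`exists_weakClass_charpoly`). It lies in the closure of the qualitative class, so strict
inequalities, such as sign changes of the polynomial, pass to genuine members of the class.

Sign singularity makes 0 a root, so only one further real root is available. A negative even cycle
would force nonzero roots of both signs, two disjoint odd cycles two distinct nonzero roots, and a
large zero block a triple root at 0. If the linear coefficient vanishes, 0 is already a double root:
no odd cycle can force another root, and the quadratic coefficient is nonzero. Otherwise a nonzero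
root has sign opposite to the linear coefficient (`mul_coeff_one_neg`), which ties the signs of odd
cycles to those of composite cycles of length `n-1`. If both signs of the linear coefficient occur,
convexity of the class produces a member where it is zero. -/

/-! ### Block-diagonal matrices and cycle decompositions of permutations. -/

theorem Matrix.det_blockDiagonal'_eq_prod {R o : Type*} [CommRing R] [Fintype o] [LinearOrder o]
    {m : o → Type*} [∀ a, Fintype (m a)] [∀ a, DecidableEq (m a)]
    (d : ∀ a, Matrix (m a) (m a) R) :
    (Matrix.blockDiagonal' d).det = ∏ a, (d a).det := by
  rw [(Matrix.blockTriangular_blockDiagonal' d).det_fintype]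
  refine Finset.prod_congr rfl fun a _ => ?_
  let e : m a ≃ {x : Σ b, m b // x.1 = a} :=
    { toFun := fun i => ⟨⟨a, i⟩, rfl⟩
      invFun := fun x => x.2 ▸ x.1.2
      left_inv := fun i => rfl
      right_inv := by rintro ⟨⟨b, i⟩, rfl⟩; rfl }
  rw [← Matrix.det_submatrix_equiv_self e]
  congr 1
  ext i j
  simp [e, Matrix.toSquareBlock_def]

theorem Matrix.charpoly_blockDiagonal' {R o : Type*} [CommRing R] [Fintype o] [LinearOrder o]
    {m : o → Type*} [∀ a, Fintype (m a)] [∀ a, DecidableEq (m a)]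
    (d : ∀ a, Matrix (m a) (m a) R) :
    (Matrix.blockDiagonal' d).charpoly = ∏ a, (d a).charpoly := by
  simp only [Matrix.charpoly]
  rw [← Matrix.det_blockDiagonal'_eq_prod]
  congr 1
  ext ⟨a, i⟩ ⟨b, j⟩ : 2
  by_cases h : a = b
  · subst h
    by_cases hij : i = j
    · subst hij; simp
    · rw [Matrix.charmatrix_apply_ne _ _ _ (by simpa using hij)]
      simp [Matrix.charmatrix_apply_ne _ _ _ hij]
  · rw [Matrix.charmatrix_apply_ne _ _ _ (by simp [h])]
    simp [Matrix.blockDiagonal'_apply_ne _ _ _ h]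

/-- Obtained by taking determinants: the permutation matrix is block diagonal. The order on `o`
serves only the block-triangular determinant formula. -/
theorem Equiv.Perm.sign_sigmaCongrRight_eq_prod {o : Type*} [Fintype o] [LinearOrder o]
    {m : o → Type*} [∀ a, Fintype (m a)] [∀ a, DecidableEq (m a)]
    (σ : ∀ a, Equiv.Perm (m a)) :
    Equiv.Perm.sign (Equiv.Perm.sigmaCongrRight σ) = ∏ a, Equiv.Perm.sign (σ a) := by
  have h : (Equiv.Perm.permMatrix ℤ (Equiv.Perm.sigmaCongrRight σ)) =
      Matrix.blockDiagonal' fun a => (σ a).permMatrix ℤ := by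
    ext ⟨a, i⟩ ⟨b, j⟩
    by_cases h : a = b
    · subst h; simp [Equiv.Perm.permMatrix, PEquiv.toMatrix_apply]
    · rw [Matrix.blockDiagonal'_apply_ne _ _ _ h]
      simp [Equiv.Perm.permMatrix, PEquiv.toMatrix_apply, h]
  have h2 := congrArg Matrix.det h
  rw [Matrix.det_permutation, Matrix.det_blockDiagonal'_eq_prod] at h2
  simp only [Matrix.det_permutation] at h2
  ext
  simpa using h2

/-- Every permutation of a finite type is conjugate to a disjoint union of rotations. -/
theorem Equiv.Perm.exists_sigma_finRotate {α : Type*} [Finite α] (σ : Equiv.Perm α) :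
    ∃ (t : ℕ) (len : Fin t → ℕ) (e : (Σ a, Fin (len a)) ≃ α), (∀ a, 0 < len a) ∧
      ∀ a i, e ⟨a, finRotate (len a) i⟩ = σ (e ⟨a, i⟩) := by
  classical
  let Q := Quotient (Equiv.Perm.SameCycle.setoid σ)
  let q := Finite.equivFin Q
  let r : Fin (Nat.card Q) → α := fun a => (q.symm a).out
  have hpos : ∀ x, 0 < Function.minimalPeriod σ x := fun x =>
    Function.minimalPeriod_pos_of_mem_periodicPts
      (σ.injective.mem_periodicPts x)
  let len : Fin (Nat.card Q) → ℕ := fun a => Function.minimalPeriod σ (r a)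
  -- Each orbit is listed as the iterates of its chosen representative, up to the minimal period.
  let f : (Σ a, Fin (len a)) → α := fun x => σ^[x.2] (r x.1)
  have hq : ∀ x : Σ a, Fin (len a), q (Quotient.mk _ (f x)) = x.1 := by
    rintro ⟨a, i⟩
    rw [← Equiv.eq_symm_apply, ← Quotient.out_eq (q.symm a)]
    refine Quotient.sound ?_
    change σ.SameCycle (σ^[i] (r a)) (r a)
    rw [← Equiv.Perm.coe_pow, Equiv.Perm.sameCycle_pow_left]
  have hf : Function.Bijective f := by
    constructor
    · rintro ⟨a, i⟩ ⟨b, j⟩ h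
      have hab : a = b := by
        have := hq ⟨a, i⟩
        rw [h, hq] at this
        exact this.symm
      subst hab
      have := Function.iterate_injOn_Iio_minimalPeriod (f := σ) (x := r a) i.2 j.2 h
      simp [Fin.ext this]
    · intro x
      have hs : σ.SameCycle (r (q (Quotient.mk _ x))) x := by
        have : (Quotient.mk (Equiv.Perm.SameCycle.setoid σ) (r (q (Quotient.mk _ x)))) =
            Quotient.mk _ x := by simp [r]
        exact Quotient.exact this
      obtain ⟨k, hk⟩ := hs.exists_nat_pow_eq
      refine ⟨⟨q (Quotient.mk _ x), ⟨k % _, Nat.mod_lt _ (hpos _)⟩⟩, ?_⟩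
      change σ^[k % _] _ = x
      rw [Function.iterate_mod_minimalPeriod_eq, ← Equiv.Perm.coe_pow, hk]
  refine ⟨Nat.card Q, len, Equiv.ofBijective f hf, fun a => hpos _, fun a i => ?_⟩
  change σ^[(finRotate (len a) i : Fin (len a))] (r a) = σ (σ^[i] (r a))
  rw [← Function.iterate_succ_apply' σ]
  have key : ∀ m (i : Fin m), ((finRotate m i : Fin m) : ℕ) = (i + 1) % m := by
    intro m i
    cases m with
    | zero => exact i.elim0
    | succ m => simp [Fin.val_add]
  rw [key, Function.iterate_mod_minimalPeriod_eq]

/-! ### The characteristic polynomial of a weighted directed cycle. -/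

/-- The weighted adjacency matrix of a directed cycle. -/
def Matrix.weightedCycle {R : Type*} [Zero R] {k : ℕ} (p : Fin k → R) : Matrix (Fin k) (Fin k) R :=
  Matrix.of fun i j => if j = finRotate k i then p i else 0

/-- If one point is rotated, injectivity forbids its successor from staying fixed. The rotation is a
single cycle, so this propagates to every point. -/
theorem Equiv.Perm.eq_one_or_eq_finRotate {k : ℕ} (σ : Equiv.Perm (Fin k))
    (h : ∀ i, σ i = i ∨ σ i = finRotate k i) : σ = 1 ∨ σ = finRotate k := by
  by_cases hk : k < 2
  · left
    have : Subsingleton (Fin k) := by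
      interval_cases k <;> infer_instance
    exact Subsingleton.elim _ _
  push Not at hk
  by_cases h1 : σ = 1
  · exact Or.inl h1
  right
  have hne : ∀ i, finRotate k i ≠ i := fun i => by
    have : i ∈ (finRotate k).support := by rw [support_finRotate_of_le hk]; simp
    simpa using this
  obtain ⟨i, hi⟩ : ∃ i, σ i ≠ i := by
    by_contra hc
    push Not at hc
    exact h1 (Equiv.ext hc)
  have hstep : ∀ j, σ j = finRotate k j → σ (finRotate k j) = finRotate k (finRotate k j) := by
    intro j hj
    refine (h _).resolve_left fun h' => hne j ?_
    exact σ.injective (h'.trans hj.symm)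
  have hpow : ∀ m : ℕ, σ ((finRotate k ^ m) i) = finRotate k ((finRotate k ^ m) i) := by
    intro m
    induction m with
    | zero => exact (h i).resolve_left hi
    | succ m ih => rw [pow_succ', Equiv.Perm.mul_apply]; exact hstep _ ih
  ext1 j
  obtain ⟨m, hm⟩ := ((isCycle_finRotate_of_le hk).sameCycle (hne i) (hne j)).exists_nat_pow_eq
  rw [← hm, hpow]

/-- Only the identity and the rotation survive in the Leibniz expansion. The rotation contributes
sign `(-1)^(k-1)` and `k` negated entries, hence the overall minus. -/
theorem Matrix.charpoly_weightedCycle {R : Type*} [CommRing R] {k : ℕ} (hk : 0 < k)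
    (p : Fin k → R) : (Matrix.weightedCycle p).charpoly = X ^ k - C (∏ i, p i) := by
  -- For `k = 1` the two surviving permutations coincide, so this case is separate.
  rcases Nat.lt_or_ge k 2 with h2 | h2
  · obtain rfl : k = 1 := by omega
    simp [Matrix.charpoly, Matrix.weightedCycle, Matrix.charmatrix_apply_eq]
  have hne : ∀ i, finRotate k i ≠ i := fun i => by
    have : i ∈ (finRotate k).support := by rw [support_finRotate_of_le h2]; simp
    simpa using this
  have hne1 : (1 : Equiv.Perm (Fin k)) ≠ finRotate k := fun h => hne ⟨0, hk⟩ (by rw [← h]; rfl)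
  rw [Matrix.charpoly, ← Matrix.det_transpose, Matrix.det_apply',
    ← Finset.sum_subset (Finset.subset_univ {1, finRotate k}), Finset.sum_pair hne1]
  · have e1 : ∀ i, (Matrix.weightedCycle p).charmatrix i i = X := fun i => by
      rw [Matrix.charmatrix_apply_eq, Matrix.weightedCycle, Matrix.of_apply,
        if_neg (hne i).symm, map_zero, sub_zero]
    have e2 : ∀ i, (Matrix.weightedCycle p).charmatrix i (finRotate k i) = - C (p i) := fun i => by
      rw [Matrix.charmatrix_apply_ne _ _ _ (hne i).symm]; simp [Matrix.weightedCycle]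
    simp only [Matrix.transpose_apply, Equiv.Perm.one_apply, e1, e2, sign_finRotate]
    obtain ⟨m, rfl⟩ : ∃ m, k = m + 1 := ⟨k - 1, by omega⟩
    simp [Finset.prod_neg, map_prod, pow_succ, ← mul_assoc, ← mul_pow, sub_eq_add_neg]
  · intro σ _ hσ
    simp only [Finset.mem_insert, Finset.mem_singleton] at hσ
    have : ∃ i, σ i ≠ i ∧ σ i ≠ finRotate k i := by
      by_contra hc
      push Not at hc
      exact hσ (σ.eq_one_or_eq_finRotate fun i => or_iff_not_imp_left.2 (hc i))
    obtain ⟨i, hi, hi'⟩ := this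
    rw [Finset.prod_eq_zero (Finset.mem_univ i), mul_zero]
    rw [Matrix.transpose_apply, Matrix.charmatrix_apply_ne _ _ _ hi.symm, Matrix.weightedCycle,
      Matrix.of_apply, if_neg hi', map_zero, neg_zero]

/-! ### The qualitative class: closure and convexity. -/

namespace SignPattern

variable {ι : Type*}

/-- The real matrices whose nonzero entries have the signs prescribed by `P`. -/
def weakClass (P : SignPattern ι) : Set (Matrix ι ι ℝ) :=
  {B | ∀ i j, B i j ≠ 0 → SignType.sign (B i j) = P i j}

theorem qualitativeClass_subset_weakClass (P : SignPattern ι) :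
    P.qualitativeClass ⊆ P.weakClass := fun _ hA i j _ => hA i j

theorem sign_coe (s : SignType) : SignType.sign (s : ℝ) = s := by
  cases s <;> simp

/-- Adding a small positive multiple of the sign matrix fills the missing entries correctly and only
pushes the nonzero ones further from 0. -/
theorem weakClass_subset_closure (P : SignPattern ι) :
    P.weakClass ⊆ closure P.qualitativeClass := by
  intro B hB
  let C : Matrix ι ι ℝ := Matrix.of fun i j => (P i j : ℝ)
  have hlim : Filter.Tendsto (fun ε : ℝ => B + ε • C) (nhdsWithin 0 (Set.Ioi 0)) (nhds B) := by
    have : Filter.Tendsto (fun ε : ℝ => B + ε • C) (nhds 0) (nhds (B + (0 : ℝ) • C)) :=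
      Continuous.tendsto (by fun_prop) 0
    rw [zero_smul, add_zero] at this
    exact this.mono_left nhdsWithin_le_nhds
  refine mem_closure_of_tendsto hlim ?_
  filter_upwards [self_mem_nhdsWithin] with ε hε i j
  have hε : 0 < ε := hε
  have hC : (B + ε • C) i j = B i j + ε * (P i j : ℝ) := rfl
  rw [hC]
  by_cases h0 : B i j = 0
  · rw [h0, zero_add, sign_mul, sign_pos hε, one_mul, sign_coe]
  · have h := hB i j h0
    rcases lt_or_gt_of_ne h0 with hlt | hgt
    · rw [sign_neg hlt] at h
      rw [← h]
      refine sign_neg ?_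
      simp only [SignType.coe_neg_one]
      linarith
    · rw [sign_pos hgt] at h
      rw [← h]
      refine sign_pos ?_
      simp only [SignType.coe_one]
      linarith

theorem convex_qualitativeClass (P : SignPattern ι) : Convex ℝ P.qualitativeClass := by
  intro A hA B hB a b ha hb hab i j
  have h1 := hA i j
  have h2 := hB i j
  change SignType.sign (a * A i j + b * B i j) = P i j
  rcases ha.eq_or_lt with rfl | ha
  · obtain rfl : b = 1 := by linarith
    simpa using h2
  generalize A i j = x at *
  generalize B i j = y at *
  rcases lt_trichotomy x 0 with hx | rfl | hx
  · rw [sign_neg hx] at h1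
    rw [← h1, sign_eq_neg_one_iff] at h2
    rw [← h1]
    refine sign_neg ?_
    nlinarith
  · rw [sign_zero] at h1
    rw [← h1, sign_eq_zero_iff] at h2
    simp [h2, h1]
  · rw [sign_pos hx] at h1
    rw [← h1, sign_eq_one_iff] at h2
    rw [← h1]
    refine sign_pos ?_
    nlinarith

theorem qualitativeClass_nonempty (P : SignPattern ι) : P.qualitativeClass.Nonempty :=
  ⟨Matrix.of fun i j => (P i j : ℝ), fun _ _ => sign_coe _⟩

/-! ### Composite cycles and coefficients of the characteristic polynomial. -/

/-- The product of the edge signs of a cycle. -/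
def SimpleCycle.edgeProd {P : SignPattern ι} (γ : P.SimpleCycle) : SignType :=
  ∏ t, P (γ.vertex t) (γ.vertex (finRotate γ.length t))

theorem SimpleCycle.edgeProd_ne_zero {P : SignPattern ι} (γ : P.SimpleCycle) : γ.edgeProd ≠ 0 :=
  Finset.prod_ne_zero_iff.2 fun t _ => γ.edge_ne_zero t

theorem SimpleCycle.sgn_of_odd {P : SignPattern ι} (γ : P.SimpleCycle) (h : Odd γ.length) :
    γ.sgn = γ.edgeProd := by
  obtain ⟨m, hm⟩ := h
  have : Even (γ.length - 1) := ⟨m, by omega⟩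
  rw [SimpleCycle.sgn, this.neg_one_pow, one_mul, edgeProd]

theorem SimpleCycle.sgn_of_even {P : SignPattern ι} (γ : P.SimpleCycle) (h : Even γ.length) :
    γ.sgn = -γ.edgeProd := by
  obtain ⟨m, hm⟩ := h
  have h0 := γ.length_pos
  have : Odd (γ.length - 1) := ⟨m - 1, by omega⟩
  rw [SimpleCycle.sgn, this.neg_one_pow, neg_one_mul, edgeProd]

/-- The factor `-edgeProd` is the constant term of `X^k - edgeProd`, the characteristic polynomial
of the bare cycle. -/
theorem SimpleCycle.coe_sgn {P : SignPattern ι} (γ : P.SimpleCycle) :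
    (γ.sgn : ℝ) = (-1) ^ γ.length * -(γ.edgeProd : ℝ) := by
  rcases Nat.even_or_odd γ.length with h | h
  · rw [γ.sgn_of_even h, h.neg_one_pow, one_mul]
    cases γ.edgeProd <;> simp
  · rw [γ.sgn_of_odd h, h.neg_one_pow, neg_one_mul, neg_neg]

theorem CompositeCycle.coe_sgn_ne_zero {P : SignPattern ι} (Γ : P.CompositeCycle) :
    (Γ.sgn : ℝ) ≠ 0 := by
  rw [← sign_ne_zero, sign_coe]
  exact Finset.prod_ne_zero_iff.2 fun a _ =>
    mul_ne_zero (pow_ne_zero _ (by decide)) (Γ.cycle a).edgeProd_ne_zero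

variable [Fintype ι] [DecidableEq ι]

/-- The vertices of a composite cycle, indexed by its cycles and the positions in them. -/
def CompositeCycle.vertexEmb {P : SignPattern ι} (Γ : P.CompositeCycle) :
    (Σ a, Fin (Γ.cycle a).length) ↪ ι where
  toFun x := (Γ.cycle x.1).vertex x.2
  inj' := by
    rintro ⟨a, i⟩ ⟨b, j⟩ h
    by_cases hab : a = b
    · subst hab
      exact congrArg (Sigma.mk a) ((Γ.cycle a).vertex.injective h)
    · exact absurd ⟨j, h.symm⟩ (Set.disjoint_left.1 (Γ.disjoint a b hab) ⟨i, rfl⟩)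

/-- The witness keeps only the edges of `Γ`, so it is block diagonal up to relabelling; the `m`
uncovered vertices give `X ^ m`. Separate weights allow the roots of different cycles to be moved
apart. -/
theorem CompositeCycle.exists_weakClass_charpoly {P : SignPattern ι} (Γ : P.CompositeCycle)
    (w : Fin Γ.count → ℝ) (hw : ∀ a, 0 < w a) :
    ∃ m, Γ.length + m = Fintype.card ι ∧ ∃ B ∈ P.weakClass, B.charpoly =
      (∏ a, (X ^ (Γ.cycle a).length - C (w a ^ (Γ.cycle a).length * ((Γ.cycle a).edgeProd : ℝ)))) *
        X ^ m := by
  classical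
  let E : (Σ a, Fin (Γ.cycle a).length) ⊕ ↥(Set.range Γ.vertexEmb)ᶜ ≃ ι :=
    (Equiv.sumCongr (Equiv.ofInjective _ Γ.vertexEmb.injective) (Equiv.refl _)).trans
      (Equiv.Set.sumCompl _)
  have hE : ∀ a i, E (Sum.inl ⟨a, i⟩) = (Γ.cycle a).vertex i := fun a i => rfl
  set M := Matrix.blockDiagonal' fun a => Matrix.weightedCycle fun t =>
    w a * (P ((Γ.cycle a).vertex t) ((Γ.cycle a).vertex (finRotate _ t)) : ℝ) with hM
  refine ⟨Fintype.card ↥(Set.range Γ.vertexEmb)ᶜ, ?_,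
    Matrix.reindex E E (Matrix.fromBlocks M 0 0 0), ?_, ?_⟩
  · rw [← Fintype.card_congr E, Fintype.card_sum, Fintype.card_sigma]
    simp [CompositeCycle.length]
  · intro i j
    obtain ⟨x, rfl⟩ := E.surjective i
    obtain ⟨y, rfl⟩ := E.surjective j
    rw [Matrix.reindex_apply, Matrix.submatrix_apply, E.symm_apply_apply, E.symm_apply_apply]
    rcases x with ⟨a, i⟩ | x <;> rcases y with ⟨b, j⟩ | y
    · rw [hE, hE, Matrix.fromBlocks_apply₁₁]
      by_cases hab : a = b
      · subst hab
        rw [hM, Matrix.blockDiagonal'_apply_eq, Matrix.weightedCycle, Matrix.of_apply]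
        split_ifs with h
        · intro _
          rw [h, sign_mul, sign_pos (hw a), one_mul, sign_coe]
        · exact fun h => absurd rfl h
      · rw [hM, Matrix.blockDiagonal'_apply_ne _ _ _ hab]
        exact fun h => absurd rfl h
    all_goals exact fun h => absurd rfl h
  · rw [Matrix.charpoly_reindex, Matrix.charpoly_fromBlocks_zero₁₂, Matrix.charpoly_zero,
      Matrix.charpoly_blockDiagonal']
    congr 1
    refine Finset.prod_congr rfl fun a _ => ?_
    rw [Matrix.charpoly_weightedCycle (Γ.cycle a).length_pos, Finset.prod_mul_distrib,
      Finset.prod_const, Finset.card_univ, Fintype.card_fin, SimpleCycle.edgeProd]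
    congr 3
    exact (map_prod (SignType.castHom : SignType →*₀ ℝ) _ _).symm

theorem CompositeCycle.exists_weakClass_coeff {P : SignPattern ι} (Γ : P.CompositeCycle) {m : ℕ}
    (hm : Γ.length + m = Fintype.card ι) :
    ∃ B ∈ P.weakClass, B.charpoly.coeff m = (-1) ^ Γ.length * (Γ.sgn : ℝ) := by
  obtain ⟨m', hm', B, hB, hc⟩ := Γ.exists_weakClass_charpoly (fun _ => 1) (fun _ => one_pos)
  obtain rfl : m' = m := by omega
  refine ⟨B, hB, ?_⟩
  rw [hc, coeff_mul_X_pow', if_pos le_rfl, Nat.sub_self, coeff_zero_eq_eval_zero, eval_prod]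
  have h1 : (Γ.sgn : ℝ) = ∏ a, ((Γ.cycle a).sgn : ℝ) :=
    map_prod (SignType.castHom : SignType →*₀ ℝ) _ _
  rw [h1, CompositeCycle.length, ← Finset.prod_pow_eq_pow_sum, ← Finset.prod_mul_distrib]
  refine Finset.prod_congr rfl fun a _ => ?_
  rw [SimpleCycle.coe_sgn, ← mul_assoc, ← mul_pow]
  simp [(Γ.cycle a).length_pos.ne']

/-- A nonvanishing term in the expansion of a principal minor comes from a composite cycle. -/
theorem exists_compositeCycle_of_prod_ne_zero {P : SignPattern ι} {A : Matrix ι ι ℝ}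
    (hA : A ∈ P.weakClass) (s : Finset ι) (σ : Equiv.Perm ↥s) (h : ∏ i : s, A i (σ i) ≠ 0) :
    ∃ Γ : P.CompositeCycle, Γ.length = s.card ∧
      Γ.sgn = SignType.sign (((Equiv.Perm.sign σ : ℤ) : ℝ) * ∏ i : s, A i (σ i)) := by
  obtain ⟨t, len, e, hlen, he⟩ := σ.exists_sigma_finRotate
  have hne : ∀ i : s, A i (σ i) ≠ 0 := fun i => Finset.prod_ne_zero_iff.1 h i (Finset.mem_univ _)
  have hP : ∀ i : s, SignType.sign (A i (σ i)) = P i (σ i) := fun i => hA _ _ (hne i)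
  let γ : Fin t → P.SimpleCycle := fun a =>
    { length := len a
      length_pos := hlen a
      vertex := ⟨fun i => e ⟨a, i⟩, fun i j hij => by simpa using e.injective (Subtype.ext hij)⟩
      edge_ne_zero := fun i => by
        change P (e ⟨a, i⟩) (e ⟨a, finRotate (len a) i⟩) ≠ 0
        rw [he, ← hP, sign_ne_zero]
        exact hne _ }
  refine ⟨⟨t, γ, ?_⟩, ?_, ?_⟩
  · intro a b hab
    rw [Set.disjoint_left]
    rintro _ ⟨i, rfl⟩ ⟨j, hj⟩
    exact hab (congrArg Sigma.fst (e.injective (Subtype.ext hj))).symm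
  · change ∑ a, len a = s.card
    rw [← Fintype.card_coe s, ← Fintype.card_congr e, Fintype.card_sigma]
    simp
  -- Conjugation by `e` turns `σ` into a disjoint union of rotations.
  · have hσ : Equiv.Perm.sign σ = ∏ a, (-1) ^ (len a - 1) := by
      rw [← Equiv.Perm.sign_symm_trans_trans σ e.symm]
      have : (e.symm.symm.trans σ).trans e.symm =
          Equiv.Perm.sigmaCongrRight fun a => finRotate (len a) := by
        ext1 ⟨a, i⟩
        simp only [Equiv.symm_symm, Equiv.trans_apply]
        rw [← he, Equiv.symm_apply_apply]
        rfl
      rw [this, Equiv.Perm.sign_sigmaCongrRight_eq_prod]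
      simp only [sign_finRotate]
    have h2 : SignType.sign (∏ i : s, A i (σ i)) = ∏ i : s, P i (σ i) := by
      rw [← Finset.prod_congr rfl fun i _ => hP i]
      exact map_prod (signHom : ℝ →*₀ SignType) _ _
    have h3 : SignType.sign (((Equiv.Perm.sign σ : ℤ) : ℝ)) = ∏ a, (-1) ^ (len a - 1) := by
      have h4 : (((Equiv.Perm.sign σ : ℤ) : ℝ)) = ∏ a, (-1) ^ (len a - 1) := by
        rw [hσ]; push_cast; rfl
      rw [h4]
      refine (map_prod (signHom : ℝ →*₀ SignType) _ _).trans (Finset.prod_congr rfl fun a _ => ?_)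
      rw [map_pow]
      congr 1
      exact sign_neg (by norm_num)
    rw [sign_mul, h2, h3, ← Equiv.prod_comp e, Fintype.prod_sigma, ← Finset.prod_mul_distrib]
    refine Finset.prod_congr rfl fun a _ => ?_
    change (-1) ^ (len a - 1) * ∏ i, P (e ⟨a, i⟩) (e ⟨a, finRotate (len a) i⟩) = _
    simp only [he]

theorem det_principalMinor {κ : Type*} [DecidableEq κ] (A : Matrix κ κ ℝ) (s : Finset κ) :
    (A.submatrix (Subtype.val : s → κ) (Subtype.val : s → κ)).det =
      ∑ σ : Equiv.Perm ↥s, ((Equiv.Perm.sign σ : ℤ) : ℝ) * ∏ i : s, A i (σ i) := by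
  rw [← Matrix.det_transpose, Matrix.det_apply']
  rfl

theorem charpoly_coeff_eq_sum (A : Matrix ι ι ℝ) {k d : ℕ} (h : k + d = Fintype.card ι) :
    A.charpoly.coeff d = (-1) ^ k * ∑ s ∈ (Finset.univ : Finset ι).powersetCard k,
      ∑ σ : Equiv.Perm ↥s, ((Equiv.Perm.sign σ : ℤ) : ℝ) * ∏ i : s, A i (σ i) := by
  have := A.charpoly_coeff_eq_sum_minors k (by omega)
  rw [← h, Nat.add_sub_cancel_left] at this
  simp only [this, det_principalMinor]

theorem continuous_charpoly_coeff (d : ℕ) :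
    Continuous fun A : Matrix ι ι ℝ => A.charpoly.coeff d := by
  by_cases hd : d ≤ Fintype.card ι
  · obtain ⟨k, hk⟩ := Nat.exists_eq_add_of_le' hd
    simp only [charpoly_coeff_eq_sum _ hk.symm]
    fun_prop
  · have : ∀ A : Matrix ι ι ℝ, A.charpoly.coeff d = 0 := fun A =>
      coeff_eq_zero_of_natDegree_lt (by rw [Matrix.charpoly_natDegree_eq_dim]; omega)
    simp only [this]
    exact continuous_const

theorem continuous_charpoly_eval (x : ℝ) :
    Continuous fun A : Matrix ι ι ℝ => A.charpoly.eval x := by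
  simp only [Matrix.eval_charpoly]
  fun_prop

theorem charpoly_coeff_eq_zero {P : SignPattern ι} {d : ℕ}
    (h : ¬ ∃ Γ : P.CompositeCycle, Γ.length + d = Fintype.card ι) {A : Matrix ι ι ℝ}
    (hA : A ∈ P.weakClass) : A.charpoly.coeff d = 0 := by
  by_cases hd : d ≤ Fintype.card ι
  · obtain ⟨k, hk⟩ := Nat.exists_eq_add_of_le' hd
    rw [charpoly_coeff_eq_sum _ hk.symm, Finset.sum_eq_zero, mul_zero]
    intro s hs
    refine Finset.sum_eq_zero fun σ _ => ?_
    by_contra hne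
    obtain ⟨Γ, hΓ, -⟩ := exists_compositeCycle_of_prod_ne_zero hA s σ (right_ne_zero_of_mul hne)
    exact h ⟨Γ, by rw [hΓ, (Finset.mem_powersetCard.1 hs).2, hk]⟩
  · exact coeff_eq_zero_of_natDegree_lt (by rw [Matrix.charpoly_natDegree_eq_dim]; omega)

/-- All terms of the expansion have the sign of `Γ` or vanish, so nothing cancels; it remains to
find one nonzero term. -/
theorem sign_charpoly_coeff {P : SignPattern ι} {k d : ℕ} (hkd : k + d = Fintype.card ι)
    (Γ : P.CompositeCycle) (hΓ : Γ.length = k)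
    (h : ∀ Γ' : P.CompositeCycle, Γ'.length = k → Γ'.sgn = Γ.sgn)
    {A : Matrix ι ι ℝ} (hA : A ∈ P.qualitativeClass) :
    0 < (Γ.sgn : ℝ) * ((-1) ^ k * A.charpoly.coeff d) := by
  have hA' := P.qualitativeClass_subset_weakClass hA
  rw [charpoly_coeff_eq_sum A hkd, ← mul_assoc ((-1) ^ k), ← mul_pow, neg_one_mul, neg_neg,
    one_pow, one_mul, Finset.mul_sum]
  have hterm : ∀ s ∈ (Finset.univ : Finset ι).powersetCard k, ∀ σ : Equiv.Perm ↥s,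
      0 ≤ (Γ.sgn : ℝ) * (((Equiv.Perm.sign σ : ℤ) : ℝ) * ∏ i : s, A i (σ i)) := by
    intro s hs σ
    by_cases h0 : ∏ i : s, A i (σ i) = 0
    · rw [h0, mul_zero, mul_zero]
    · obtain ⟨Γ', h1, h2⟩ := exists_compositeCycle_of_prod_ne_zero hA' s σ h0
      rw [← h Γ' (h1.trans (Finset.mem_powersetCard.1 hs).2), h2, sign_mul_self]
      exact abs_nonneg _
  obtain ⟨s, hs, σ, hσ⟩ : ∃ s ∈ (Finset.univ : Finset ι).powersetCard k, ∃ σ : Equiv.Perm ↥s,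
      ∏ i : s, A i (σ i) ≠ 0 := by
    -- The matrix supported on `Γ` has a nonzero coefficient, hence a nonzero term; its nonzero
    -- entries are also nonzero in `A`.
    obtain ⟨B, hB, hBc⟩ := Γ.exists_weakClass_coeff (hΓ ▸ hkd)
    by_contra! hc
    rw [charpoly_coeff_eq_sum B hkd, Finset.sum_eq_zero, mul_zero] at hBc
    · exact mul_ne_zero (pow_ne_zero _ (by norm_num)) Γ.coe_sgn_ne_zero hBc.symm
    · intro s hs
      refine Finset.sum_eq_zero fun σ _ => ?_
      obtain ⟨i, -, hi⟩ := Finset.prod_eq_zero_iff.1 (hc s hs σ)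
      have : P i (σ i) = 0 := by rw [← hA, hi, sign_zero]
      rw [Finset.prod_eq_zero (Finset.mem_univ i), mul_zero]
      by_contra hb
      have := hB _ _ hb
      simp_all
  refine Finset.sum_pos' (fun s hs => ?_) ⟨s, hs, ?_⟩
  · rw [Finset.mul_sum]
    exact Finset.sum_nonneg fun σ _ => hterm s hs σ
  · rw [Finset.mul_sum]
    refine Finset.sum_pos' (fun σ _ => hterm s hs σ) ⟨σ, Finset.mem_univ _, ?_⟩
    obtain ⟨Γ', h1, h2⟩ := exists_compositeCycle_of_prod_ne_zero hA' s σ hσ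
    rw [← h Γ' (h1.trans (Finset.mem_powersetCard.1 hs).2), h2, sign_mul_self, abs_pos]
    exact mul_ne_zero (by simp) hσ

end SignPattern

/-! ### Locating and counting real roots. -/

/-- The factor `c = ±1` treats positive and negative intervals together, through the intermediate
value theorem for `y ↦ q (c y)`. -/
theorem Polynomial.exists_root_of_mul_neg (q : ℝ[X]) {c u v : ℝ} (huv : u < v) (hc : c * c = 1)
    (h : q.eval (c * u) * q.eval (c * v) < 0) : ∃ x, q.IsRoot x ∧ u < c * x ∧ c * x < v := by
  have hf : ContinuousOn (fun y => q.eval (c * y)) (Set.Icc u v) := by fun_prop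
  have : ∃ y ∈ Set.Ioo u v, q.eval (c * y) = 0 := by
    rcases mul_neg_iff.1 h with ⟨h1, h2⟩ | ⟨h1, h2⟩
    · exact intermediate_value_Ioo' huv.le hf ⟨h2, h1⟩
    · exact intermediate_value_Ioo huv.le hf ⟨h1, h2⟩
  obtain ⟨y, ⟨hy1, hy2⟩, hy⟩ := this
  exact ⟨c * y, hy, by rwa [← mul_assoc, hc, one_mul], by rwa [← mul_assoc, hc, one_mul]⟩

theorem Polynomial.add_card_le_card_roots {q : ℝ[X]} (hq : q ≠ 0) {m : ℕ} (hm : X ^ m ∣ q)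
    (T : Finset ℝ) (hT : ∀ x ∈ T, x ≠ 0 ∧ q.IsRoot x) : m + T.card ≤ q.roots.card := by
  have : Multiset.replicate m 0 + T.val ≤ q.roots := by
    rw [Multiset.le_iff_count]
    intro x
    rw [Multiset.count_add, Multiset.count_replicate, count_roots]
    by_cases hx : x ∈ T
    · obtain ⟨h0, hr⟩ := hT x hx
      rw [if_neg (Ne.symm h0), zero_add, Multiset.count_eq_one_of_mem T.nodup hx]
      exact (rootMultiplicity_pos hq).2 hr
    · rw [Multiset.count_eq_zero_of_notMem (by simpa using hx), add_zero]
      split_ifs with h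
      · subst h
        rw [le_rootMultiplicity_iff hq]
        simpa using hm
      · exact Nat.zero_le _
  simpa using Multiset.card_le_card this

theorem Polynomial.eval_pos_of_monic_of_no_root {g : ℝ[X]} (hg : g.Monic) (h : ∀ x, ¬ g.IsRoot x)
    (x : ℝ) : 0 < g.eval x := by
  rcases Nat.eq_zero_or_pos g.natDegree with h0 | h0
  · rw [(hg.natDegree_eq_zero).1 h0]; simp
  · by_contra! hx
    have ht := g.tendsto_atTop_of_leadingCoeff_nonneg (natDegree_pos_iff_degree_pos.1 h0)
      (by rw [hg.leadingCoeff]; exact zero_le_one)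
    obtain ⟨y, hy1, hy2⟩ := ((ht.eventually_ge_atTop 0).and (Filter.eventually_ge_atTop x)).exists
    obtain ⟨z, -, hz⟩ := intermediate_value_Icc hy2 (f := fun t => g.eval t) (by fun_prop) ⟨hx, hy1⟩
    exact h z hz

/-- Here `q = X (X - x) g` with `g` monic without real roots, so `g(0) > 0` and the linear
coefficient is `-x g(0)`. -/
theorem Polynomial.mul_coeff_one_neg {q : ℝ[X]} (hq : q.Monic) (h2 : q.roots.card = 2)
    (h0 : q.IsRoot 0) {x : ℝ} (hx : q.IsRoot x) (hx0 : x ≠ 0) : x * q.coeff 1 < 0 := by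
  obtain ⟨g, hg, -, hgr⟩ := exists_prod_multiset_X_sub_C_mul q
  have hroots : q.roots = {0, x} := by
    refine (Multiset.eq_of_le_of_card_le (s := {0, x}) ?_ (by simp [h2])).symm
    rw [Multiset.le_iff_subset (by simpa using hx0.symm)]
    intro y hy
    simp only [Multiset.insert_eq_cons, Multiset.mem_cons, Multiset.mem_singleton] at hy
    rcases hy with rfl | rfl
    · exact (mem_roots hq.ne_zero).2 h0
    · exact (mem_roots hq.ne_zero).2 hx
  rw [hroots] at hg
  simp only [Multiset.insert_eq_cons, Multiset.map_cons, Multiset.map_singleton,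
    Multiset.prod_cons, Multiset.prod_singleton, map_zero, sub_zero] at hg
  have hgm : g.Monic := by
    refine Monic.of_mul_monic_left (p := X * (X - C x)) ?_ (hg ▸ hq)
    exact monic_X.mul (monic_X_sub_C x)
  have hpos := eval_pos_of_monic_of_no_root hgm (fun y hy => by
    have := (mem_roots hgm.ne_zero).2 hy
    simp [hgr] at this) 0
  have : q.coeff 1 = -x * g.eval 0 := by
    rw [← hg, mul_assoc, coeff_X_mul, coeff_zero_eq_eval_zero]
    simp
  rw [this]
  have := mul_pos (mul_self_pos.2 hx0) hpos
  linarith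

/-- Odd powers are strictly increasing; this reduces sign checks of cycle factors to linear ones. -/
theorem sign_pow_sub_pow_of_odd {k : ℕ} (hk : Odd k) (x y : ℝ) :
    SignType.sign (x ^ k - y ^ k) = SignType.sign (x - y) := by
  rcases lt_trichotomy x y with h | rfl | h
  · rw [sign_neg (sub_neg.2 h), sign_neg (sub_neg.2 (hk.strictMono_pow h))]
  · simp
  · rw [sign_pos (sub_pos.2 h), sign_pos (sub_pos.2 (hk.strictMono_pow h))]

/-! ### Real roots forced by cycles, and multiplicity forced by zero blocks. -/

namespace SignPattern

variable {ι : Type*}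

theorem coe_mul_self {s : SignType} (hs : s ≠ 0) : (s : ℝ) * s = 1 := by
  cases s <;> simp_all

theorem coe_pow_of_odd (s : SignType) {k : ℕ} (hk : Odd k) : (s : ℝ) ^ k = s := by
  cases s <;> simp [hk.neg_one_pow, hk.pos.ne']

/-- The composite cycle consisting of a single cycle. -/
def SimpleCycle.toComposite {P : SignPattern ι} (γ : P.SimpleCycle) : P.CompositeCycle where
  count := 1
  cycle := fun _ => γ
  disjoint := fun a b h => absurd (Subsingleton.elim a b) h

/-- The composite cycle consisting of two disjoint cycles. -/
def SimpleCycle.pair {P : SignPattern ι} (γ δ : P.SimpleCycle)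
    (h : Disjoint γ.support δ.support) : P.CompositeCycle where
  count := 2
  cycle := ![γ, δ]
  disjoint := by
    intro a b hab
    fin_cases a <;> fin_cases b
    · exact absurd rfl hab
    · exact h
    · exact h.symm
    · exact absurd rfl hab

/-- A cycle in a principal subpattern, viewed as a cycle in the whole pattern. -/
def SimpleCycle.ofPrincipal {P : SignPattern ι} {s : Set ι} (δ : (P.principal s).SimpleCycle) :
    P.SimpleCycle where
  length := δ.length
  length_pos := δ.length_pos
  vertex := δ.vertex.trans (Function.Embedding.subtype _)
  edge_ne_zero := δ.edge_ne_zero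

theorem SimpleCycle.support_ofPrincipal_subset {P : SignPattern ι} {s : Set ι}
    (δ : (P.principal s).SimpleCycle) : δ.ofPrincipal.support ⊆ s := by
  rintro _ ⟨t, rfl⟩
  exact (δ.vertex t).2

variable [Fintype ι] [DecidableEq ι]

theorem SimpleCycle.exists_root_of_odd {P : SignPattern ι} (γ : P.SimpleCycle)
    (hγ : Odd γ.length) :
    ∃ A ∈ P.qualitativeClass, ∃ x, A.charpoly.IsRoot x ∧ 0 < (γ.sgn : ℝ) * x := by
  obtain ⟨m, -, B, hB, hc⟩ :=
    γ.toComposite.exists_weakClass_charpoly (fun _ => 1) (fun _ => one_pos)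
  rw [γ.sgn_of_odd hγ]
  have hs := coe_mul_self γ.edgeProd_ne_zero
  have hp := coe_pow_of_odd γ.edgeProd hγ
  set c : ℝ := (γ.edgeProd : ℝ) with hcdef
  have hev : ∀ x, B.charpoly.eval x = (x ^ γ.length - c ^ γ.length) * x ^ m := by
    intro x
    rw [hc, eval_mul, eval_prod]
    change (∏ j : Fin 1, _) * _ = _
    rw [Fin.prod_univ_one, hp]
    simp [SimpleCycle.toComposite, hcdef]
  -- The test points `c/2` and `2c` straddle the root `c` but lie on the same side of 0, so the
  -- factor `x ^ m` does not affect the sign change.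
  have hneg : B.charpoly.eval (c * (1 / 2)) * B.charpoly.eval (c * 2) < 0 := by
    rw [← sign_eq_neg_one_iff, hev, hev, mul_mul_mul_comm, ← mul_pow, sign_mul, sign_mul,
      sign_pow_sub_pow_of_odd hγ, sign_pow_sub_pow_of_odd hγ, ← sign_mul, ← sign_mul,
      sign_eq_neg_one_iff]
    have h1 : c * (1 / 2) * (c * 2) = 1 := by linarith
    have h2 : (c * (1 / 2) - c) * (c * 2 - c) = -(1 / 2) := by linarith
    rw [h1, h2]
    norm_num
  have hopen : IsOpen {A : Matrix ι ι ℝ |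
      A.charpoly.eval (c * (1 / 2)) * A.charpoly.eval (c * 2) < 0} :=
    isOpen_lt ((continuous_charpoly_eval _).mul (continuous_charpoly_eval _)) continuous_const
  obtain ⟨A, hA1, hA2⟩ := mem_closure_iff.1 (P.weakClass_subset_closure hB) _ hopen hneg
  obtain ⟨x, hx, hx1, -⟩ := A.charpoly.exists_root_of_mul_neg (by norm_num) hs hA1
  exact ⟨A, hA2, x, hx, by linarith⟩

theorem SimpleCycle.exists_roots_of_even {P : SignPattern ι} (γ : P.SimpleCycle)
    (hγ : Even γ.length) (hneg : γ.sgn < 0) :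
    ∃ A ∈ P.qualitativeClass, ∃ x y, A.charpoly.IsRoot x ∧ A.charpoly.IsRoot y ∧ x < 0 ∧ 0 < y := by
  obtain ⟨m, -, B, hB, hc⟩ :=
    γ.toComposite.exists_weakClass_charpoly (fun _ => 1) (fun _ => one_pos)
  -- Even length with negative sign means edge product `+1`, so both `1` and `-1` are roots of `x^k
  -- - 1`.
  have hp : γ.edgeProd = 1 := by
    rw [γ.sgn_of_even hγ] at hneg
    generalize γ.edgeProd = s at hneg
    revert hneg; revert s; decide
  have hev : ∀ x, B.charpoly.eval x = (x ^ γ.length - 1) * x ^ m := by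
    intro x
    rw [hc, eval_mul, eval_prod]
    change (∏ j : Fin 1, _) * _ = _
    rw [Fin.prod_univ_one]
    simp [SimpleCycle.toComposite, hp]
  have h2 : (2 : ℝ) ^ γ.length - 1 > 0 := by
    have := one_lt_pow₀ (a := (2 : ℝ)) (by norm_num) γ.length_pos.ne'
    linarith
  have h3 : (1 / 2 : ℝ) ^ γ.length - 1 < 0 := by
    have := pow_lt_one₀ (a := (1 / 2 : ℝ)) (by norm_num) (by norm_num) γ.length_pos.ne'
    linarith
  have key : ∀ c : ℝ, c * c = 1 → c ^ γ.length = 1 →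
      B.charpoly.eval (c * (1 / 2)) * B.charpoly.eval (c * 2) < 0 := by
    intro c hcc hck
    have h1 : c * (1 / 2) * (c * 2) = 1 := by linarith
    rw [hev, hev, mul_mul_mul_comm, ← mul_pow _ _ m, h1, one_pow, mul_one, mul_pow, mul_pow, hck,
      one_mul, one_mul]
    exact mul_neg_of_neg_of_pos h3 h2
  have hopen : ∀ c : ℝ, IsOpen {A : Matrix ι ι ℝ |
      A.charpoly.eval (c * (1 / 2)) * A.charpoly.eval (c * 2) < 0} := fun c =>
    isOpen_lt ((continuous_charpoly_eval _).mul (continuous_charpoly_eval _)) continuous_const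
  obtain ⟨A, hA1, hA2⟩ := mem_closure_iff.1 (P.weakClass_subset_closure hB) _
    ((hopen 1).inter (hopen (-1))) ⟨key 1 (by norm_num) (by simp),
      key (-1) (by norm_num) hγ.neg_one_pow⟩
  obtain ⟨y, hy, hy1, -⟩ := A.charpoly.exists_root_of_mul_neg (by norm_num) (by norm_num) hA1.1
  obtain ⟨x, hx, hx1, -⟩ := A.charpoly.exists_root_of_mul_neg (by norm_num) (by norm_num) hA1.2
  exact ⟨A, hA2, x, y, hx, hy, by linarith, by linarith⟩

theorem SimpleCycle.exists_roots_of_disjoint_odd {P : SignPattern ι} (γ δ : P.SimpleCycle)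
    (h : Disjoint γ.support δ.support) (hγ : Odd γ.length) (hδ : Odd δ.length) :
    ∃ A ∈ P.qualitativeClass, ∃ x y, A.charpoly.IsRoot x ∧ A.charpoly.IsRoot y ∧
      x ≠ 0 ∧ y ≠ 0 ∧ x ≠ y := by
  obtain ⟨m, -, B, hB, hc⟩ :=
    -- Weights 1 and 4 put the roots at `c` and `4d` with `c, d = ±1`. The windows `1/2 < |x| < 2`
    -- and `2 < |y| < 8` are disjoint, so the perturbed roots stay distinct even when `c = d`.
    (γ.pair δ h).exists_weakClass_charpoly (![1, 4] : Fin 2 → ℝ)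
      (fun a => by change Fin 2 at a; fin_cases a <;> simp)
  have hs : ∀ s : SignType, s ≠ 0 → (s : ℝ) = 1 ∨ (s : ℝ) = -1 := by
    intro s hs; cases s <;> simp_all
  have hp := coe_pow_of_odd γ.edgeProd hγ
  have hq := coe_pow_of_odd δ.edgeProd hδ
  have hc1 := hs _ γ.edgeProd_ne_zero
  have hd1 := hs _ δ.edgeProd_ne_zero
  have hev : ∀ x, B.charpoly.eval x = (x ^ γ.length - (γ.edgeProd : ℝ) ^ γ.length) *
      (x ^ δ.length - (4 * (δ.edgeProd : ℝ)) ^ δ.length) * x ^ m := by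
    intro x
    rw [hc, eval_mul, eval_prod]
    change (∏ j : Fin 2, _) * _ = _
    rw [Fin.prod_univ_two, mul_pow 4, hp, hq]
    simp [SimpleCycle.pair]
  generalize (γ.edgeProd : ℝ) = c at *
  generalize (δ.edgeProd : ℝ) = d at *
  have hmul : ∀ a b, 0 < a * b → (a - c) * (b - c) * ((a - 4 * d) * (b - 4 * d)) < 0 →
      B.charpoly.eval a * B.charpoly.eval b < 0 := by
    intro a b h1 h2
    rw [← sign_eq_neg_one_iff] at h2 ⊢
    rw [hev, hev, mul_mul_mul_comm, ← mul_pow, sign_mul, sign_pos (pow_pos h1 m), mul_one,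
      mul_mul_mul_comm]
    simpa only [sign_mul, sign_pow_sub_pow_of_odd hγ, sign_pow_sub_pow_of_odd hδ] using h2
  have hn1 : B.charpoly.eval (c * (1 / 2)) * B.charpoly.eval (c * 2) < 0 := by
    apply hmul <;> rcases hc1 with rfl | rfl <;> rcases hd1 with rfl | rfl <;> norm_num
  have hn2 : B.charpoly.eval (d * 2) * B.charpoly.eval (d * 8) < 0 := by
    apply hmul <;> rcases hc1 with rfl | rfl <;> rcases hd1 with rfl | rfl <;> norm_num
  have hopen : ∀ a b : ℝ, IsOpen {A : Matrix ι ι ℝ |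
      A.charpoly.eval a * A.charpoly.eval b < 0} := fun a b =>
    isOpen_lt ((continuous_charpoly_eval _).mul (continuous_charpoly_eval _)) continuous_const
  obtain ⟨A, hA1, hA2⟩ := mem_closure_iff.1 (P.weakClass_subset_closure hB) _
    ((hopen _ _).inter (hopen _ _)) ⟨hn1, hn2⟩
  have hcc : c * c = 1 := by rcases hc1 with rfl | rfl <;> norm_num
  have hdd : d * d = 1 := by rcases hd1 with rfl | rfl <;> norm_num
  obtain ⟨x, hx, hx1, hx2⟩ := A.charpoly.exists_root_of_mul_neg (by norm_num) hcc hA1.1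
  obtain ⟨y, hy, hy1, -⟩ := A.charpoly.exists_root_of_mul_neg (by norm_num) hdd hA1.2
  refine ⟨A, hA2, x, y, hx, hy, ?_, ?_, ?_⟩
  · rintro rfl; linarith
  · rintro rfl; linarith
  · rintro rfl
    rcases hc1 with rfl | rfl <;> rcases hd1 with rfl | rfl <;> linarith

/-- A matrix with an `α × β` zero block has no nonvanishing principal minor of large order. -/
theorem X_pow_dvd_charpoly_of_zero_block {P : SignPattern ι} {α β : Finset ι}
    (h : ∀ i ∈ α, ∀ j ∈ β, P i j = 0) {m : ℕ} (hm : Fintype.card ι + m ≤ α.card + β.card)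
    {A : Matrix ι ι ℝ} (hA : A ∈ P.qualitativeClass) : X ^ m ∣ A.charpoly := by
  rw [X_pow_dvd_iff]
  intro d hd
  have hα := α.card_le_univ
  have hβ := β.card_le_univ
  obtain ⟨k, hk⟩ := Nat.exists_eq_add_of_le' (show d ≤ Fintype.card ι by omega)
  rw [charpoly_coeff_eq_sum _ hk.symm, Finset.sum_eq_zero, mul_zero]
  intro s hs
  refine Finset.sum_eq_zero fun σ _ => ?_
  have hsk := (Finset.mem_powersetCard.1 hs).2
  -- Restricting to `s` loses at most `d` indices, the size of the complement.
  have hcard : ∀ τ : Finset ι, τ.card ≤ (τ.subtype (· ∈ s)).card + d := by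
    intro τ
    have h1 : (τ \ s).card ≤ sᶜ.card :=
      Finset.card_le_card fun i hi => Finset.mem_compl.2 (Finset.mem_sdiff.1 hi).2
    rw [Finset.card_compl] at h1
    have h2 := Finset.card_inter_add_card_sdiff τ s
    rw [Finset.card_subtype, Finset.filter_mem_eq_inter]
    omega
  -- Otherwise `σ` sends `α ∩ s` into `s` off `β`, so `|α| + |β| ≤ (n - d) + 2d = n + d < n + m`.
  obtain ⟨i, hiα, hiβ⟩ : ∃ i : s, (i : ι) ∈ α ∧ (σ i : ι) ∈ β := by
    by_contra! hc
    have hdisj : Disjoint ((α.subtype (· ∈ s)).map σ.toEmbedding) (β.subtype (· ∈ s)) := by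
      rw [Finset.disjoint_left]
      intro j hj hj'
      obtain ⟨i, hi, rfl⟩ := Finset.mem_map.1 hj
      exact hc i (Finset.mem_subtype.1 hi) (Finset.mem_subtype.1 hj')
    have h1 := Finset.card_le_univ (((α.subtype (· ∈ s)).map σ.toEmbedding).disjUnion _ hdisj)
    rw [Finset.card_disjUnion, Finset.card_map, Fintype.card_coe] at h1
    have h2 := hcard α
    have h3 := hcard β
    omega
  have h0 : A i (σ i) = 0 := by
    rw [← sign_eq_zero_iff, hA, h _ hiα _ hiβ]
  rw [Finset.prod_eq_zero (Finset.mem_univ i) h0, mul_zero]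

end SignPattern

/-! ### The six conclusions by root counting. -/

theorem theorem5p3 (n : ℕ) (P : SignPattern (Fin n))
    (hsing : P.SignSingular) (hcons : P.IsConsistentOf 2) :
    -- all even cycles are nonnegative
    (∀ γ : P.SimpleCycle, Even γ.length → 0 ≤ γ.sgn) ∧
    -- every `p × q` zero submatrix has `p + q ≤ n + 2`
    (∀ α β : Finset (Fin n), (∀ i ∈ α, ∀ j ∈ β, P i j = 0) → α.card + β.card ≤ n + 2) ∧
    -- no odd cycle in the complement of an odd cycle
    (∀ γ : P.SimpleCycle, Odd γ.length →
      ¬ ∃ δ : (P.principal γ.supportᶜ).SimpleCycle, Odd δ.length) ∧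
    -- no composite cycle of length `n - 1`
    ((¬ ∃ Γ : P.CompositeCycle, Γ.length + 1 = n) →
      (∀ γ : P.SimpleCycle, Even γ.length ∧ 0 ≤ γ.sgn) ∧
      ∃ Γ : P.CompositeCycle, Γ.length + 2 = n) ∧
    -- composite cycles of length `n - 1` exist and all have the same sign
    ((∃ Γ : P.CompositeCycle, Γ.length + 1 = n) →
      (∀ Γ₁ Γ₂ : P.CompositeCycle, Γ₁.length + 1 = n → Γ₂.length + 1 = n → Γ₁.sgn = Γ₂.sgn) →
      ∀ γ₁ γ₂ : P.SimpleCycle, Odd γ₁.length → Odd γ₂.length → γ₁.sgn = γ₂.sgn) ∧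
    -- oppositely signed composite cycles of length `n - 1`
    ((∃ Γ₁ Γ₂ : P.CompositeCycle, Γ₁.length + 1 = n ∧ Γ₂.length + 1 = n ∧ Γ₁.sgn = -Γ₂.sgn) →
      ∃ Γ : P.CompositeCycle, Γ.length + 2 = n) := by
  have hne : ∀ A : Matrix (Fin n) (Fin n) ℝ, A.charpoly ≠ 0 := fun A => A.charpoly_monic.ne_zero
  have hcoeff0 : ∀ A ∈ P.qualitativeClass, A.charpoly.coeff 0 = 0 := fun A hA => by
    have := A.det_eq_sign_charpoly_coeff
    rw [hsing A hA] at this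
    exact (mul_eq_zero.1 this.symm).resolve_left (pow_ne_zero _ (by norm_num))
  have hroot0 : ∀ A ∈ P.qualitativeClass, A.charpoly.IsRoot 0 := fun A hA => by
    rw [Polynomial.IsRoot, ← Polynomial.coeff_zero_eq_eval_zero, hcoeff0 A hA]
  have hdvd1 : ∀ A ∈ P.qualitativeClass, X ^ 1 ∣ A.charpoly := fun A hA => by
    rw [pow_one, X_dvd_iff]; exact hcoeff0 A hA
  have hcount : ∀ A ∈ P.qualitativeClass, ∀ m, X ^ m ∣ A.charpoly →
      ∀ T : Finset ℝ, (∀ x ∈ T, x ≠ 0 ∧ A.charpoly.IsRoot x) → m + T.card ≤ 2 :=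
    fun A hA m hm T hT => (hcons A hA) ▸ Polynomial.add_card_le_card_roots (hne A) hm T hT
  -- With no composite cycle of length `n-2` the quadratic coefficient vanishes as well, making 0 a
  -- triple root.
  have hcoeff2 : ∀ A ∈ P.qualitativeClass, A.charpoly.coeff 1 = 0 →
      ∃ Γ : P.CompositeCycle, Γ.length + 2 = n := by
    intro A hA h1
    by_contra hno
    have h2 : A.charpoly.coeff 2 = 0 := SignPattern.charpoly_coeff_eq_zero
      (by simpa using hno) (P.qualitativeClass_subset_weakClass hA)
    have hd : X ^ 3 ∣ A.charpoly := by
      rw [X_pow_dvd_iff]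
      intro d hd
      interval_cases d
      exacts [hcoeff0 A hA, h1, h2]
    have := hcount A hA 3 hd ∅ (by simp)
    omega
  have heven : ∀ γ : P.SimpleCycle, Even γ.length → 0 ≤ γ.sgn := by
    intro γ hγ
    by_contra! hneg
    obtain ⟨A, hA, x, y, hx, hy, hx0, hy0⟩ := γ.exists_roots_of_even hγ hneg
    have := hcount A hA 1 (hdvd1 A hA) {x, y} (by
      simp only [Finset.mem_insert, Finset.mem_singleton]
      rintro z (rfl | rfl)
      exacts [⟨hx0.ne, hx⟩, ⟨hy0.ne', hy⟩])
    rw [Finset.card_pair (by linarith)] at this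
    omega
  refine ⟨heven, ?_, ?_, ?_, ?_, ?_⟩
  · intro α β h
    by_contra! hlt
    obtain ⟨A, hA⟩ := P.qualitativeClass_nonempty
    have := hcount A hA 3 (SignPattern.X_pow_dvd_charpoly_of_zero_block h (by simp; omega) hA) ∅
      (by simp)
    omega
  · rintro γ hγ ⟨δ, hδ⟩
    obtain ⟨A, hA, x, y, hx, hy, hx0, hy0, hxy⟩ := γ.exists_roots_of_disjoint_odd δ.ofPrincipal
      (Set.disjoint_left.2 fun i hi hi' => δ.support_ofPrincipal_subset hi' hi) hγ hδ
    have := hcount A hA 1 (hdvd1 A hA) {x, y} (by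
      simp only [Finset.mem_insert, Finset.mem_singleton]
      rintro z (rfl | rfl)
      exacts [⟨hx0, hx⟩, ⟨hy0, hy⟩])
    rw [Finset.card_pair hxy] at this
    omega
  · intro hno
    have h1 : ∀ A ∈ P.qualitativeClass, A.charpoly.coeff 1 = 0 := fun A hA =>
      SignPattern.charpoly_coeff_eq_zero (by simpa using hno)
        (P.qualitativeClass_subset_weakClass hA)
    refine ⟨fun γ => ?_, ?_⟩
    -- 0 is now a double root, so the nonzero root forced by an odd cycle would be a third.
    · have hev : Even γ.length := by
        by_contra hodd
        obtain ⟨A, hA, x, hx, hx0⟩ := γ.exists_root_of_odd (Nat.not_even_iff_odd.1 hodd)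
        have hd : X ^ 2 ∣ A.charpoly := by
          rw [X_pow_dvd_iff]
          intro d hd
          interval_cases d
          exacts [hcoeff0 A hA, h1 A hA]
        have := hcount A hA 2 hd {x} (by
          simp only [Finset.mem_singleton]
          rintro z rfl
          exact ⟨right_ne_zero_of_mul hx0.ne', hx⟩)
        simp at this
      exact ⟨hev, heven γ hev⟩
    · obtain ⟨A, hA⟩ := P.qualitativeClass_nonempty
      exact hcoeff2 A hA (h1 A hA)
  · rintro ⟨Γ, hΓ⟩ hall
    -- The linear coefficient has the fixed sign of `Γ.sgn * (-1)^Γ.length`, and the nonzero root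
    -- has the sign of `γ`; these must be opposite.
    have hsign : ∀ γ : P.SimpleCycle, Odd γ.length →
        (γ.sgn : ℝ) * ((Γ.sgn : ℝ) * (-1) ^ Γ.length) < 0 := by
      intro γ hγ
      obtain ⟨A, hA, x, hx, hx0⟩ := γ.exists_root_of_odd hγ
      have h1 := SignPattern.sign_charpoly_coeff (d := 1) (by simpa using hΓ) Γ rfl
        (fun Γ' h' => hall _ _ (by omega) hΓ) hA
      have h2 := Polynomial.mul_coeff_one_neg A.charpoly_monic (hcons A hA) (hroot0 A hA) hx
        (right_ne_zero_of_mul hx0.ne')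
      rw [← mul_assoc] at h1
      have h3 := mul_pos h1 hx0
      by_contra! hge
      nlinarith
    intro γ₁ γ₂ h1 h2
    have e1 := hsign γ₁ h1
    have e2 := hsign γ₂ h2
    have e3 := mul_pos_of_neg_of_neg e1 e2
    have e4 : 0 < (γ₁.sgn : ℝ) * γ₂.sgn := by
      by_contra! hle
      nlinarith [mul_self_nonneg ((Γ.sgn : ℝ) * (-1) ^ Γ.length)]
    generalize γ₁.sgn = a at e4
    generalize γ₂.sgn = b at e4
    cases a <;> cases b <;> first | rfl | (norm_num at e4)
  · rintro ⟨Γ₁, Γ₂, h1, h2, hopp⟩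
    -- Near the matrix supported on `Γ`, the linear coefficient keeps the sign dictated by `Γ`.
    have hmem : ∀ Γ : P.CompositeCycle, Γ.length + 1 = n → ∃ A ∈ P.qualitativeClass,
        0 < ((-1) ^ Γ.length * (Γ.sgn : ℝ)) * A.charpoly.coeff 1 := by
      intro Γ hΓ
      obtain ⟨B, hB, hBc⟩ := Γ.exists_weakClass_coeff (m := 1) (by simpa using hΓ)
      have hopen : IsOpen {A : Matrix (Fin n) (Fin n) ℝ |
          0 < ((-1) ^ Γ.length * (Γ.sgn : ℝ)) * A.charpoly.coeff 1} :=
        isOpen_lt continuous_const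
          (continuous_const.mul (SignPattern.continuous_charpoly_coeff 1))
      obtain ⟨A, hA1, hA2⟩ := mem_closure_iff.1 (P.weakClass_subset_closure hB) _ hopen (by
        rw [Set.mem_ofPred_eq, hBc]
        exact mul_self_pos.2 (mul_ne_zero (pow_ne_zero _ (by norm_num)) Γ.coe_sgn_ne_zero))
      exact ⟨A, hA2, hA1⟩
    obtain ⟨A₁, hA₁, hc₁⟩ := hmem Γ₁ h1
    obtain ⟨A₂, hA₂, hc₂⟩ := hmem Γ₂ h2
    have hlen : Γ₁.length = Γ₂.length := by omega
    have hs : (Γ₁.sgn : ℝ) = -(Γ₂.sgn : ℝ) := by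
      rw [hopp]; cases Γ₂.sgn <;> simp
    rw [hlen, hs] at hc₁
    have hpre := P.convex_qualitativeClass.isPreconnected
    have hcont := (SignPattern.continuous_charpoly_coeff (ι := Fin n) 1).continuousOn
      (s := P.qualitativeClass)
    -- The coefficient takes opposite signs at `A₁` and `A₂`, and the class is connected; the case
    -- split only decides which endpoint is negative.
    have : ∃ A ∈ P.qualitativeClass, A.charpoly.coeff 1 = 0 := by
      rw [mul_neg, neg_mul, neg_pos] at hc₁
      rcases lt_trichotomy ((-1) ^ Γ₂.length * (Γ₂.sgn : ℝ)) 0 with hc | hc | hc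
      · exact hpre.intermediate_value hA₂ hA₁ hcont
          ⟨(neg_of_mul_pos_right hc₂ hc.le).le, (pos_of_mul_neg_right hc₁ hc.le).le⟩
      · simp [hc] at hc₁
      · exact hpre.intermediate_value hA₁ hA₂ hcont
          ⟨(neg_of_mul_neg_right hc₁ hc.le).le, (pos_of_mul_pos_right hc₂ hc.le).le⟩
    obtain ⟨A, hA, hA0⟩ := this
    exact hcoeff2 A hA hA0
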